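/- Call a semigroup a semilattice if it is commutative and all its elements are idempotent. A semigroup $S$ is called semilattice indecomposable if every homomorphic image of $S$ that is a semilattice has exactly one element. A semigroup $S$ is called $B_2$-combinatorial if $S$ is semilattice indecomposable, $|S|=4k+1$ for some integer $k\ge 0$, and $S$ has a subsemigroup $Y$ which is a semilattice with $|Y|=2k+1$. Let $S$ be a $B_2$-combinatorial semigroup with $|S|=4k+1$. Then all of the following assertions hold. (i) $S$ has a zero, that is, an element $z$ with $zs=sz=z$ for all $s\in S$. (ii) The semigroup algebra $\mathbb{C}[S]$ is isomorphic, as an algebra over $\mathbb{C}$, to $\mathbb{C}\oplus\bigoplus_{i=1}^k M_2(\mathbb{C})$, where $M_2(\mathbb{C})$ is the algebra of complex $2\times 2$ matrices. (iii) Every nonempty two-sided ideal of $S$, as a semigroup under the multiplication of $S$, is $B_2$-combinatorial. (iv) Every homomorphic image of $S$ is $B_2$-combinatorial. -/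

import Mathlib

universe u v

/-- A semigroup is a semilattice if it is commutative and all its elements are idempotent. -/
def IsSemilatticeSemigroup (S : Type u) [Semigroup S] : Prop :=
  (∀ x y : S, x * y = y * x) ∧ ∀ x : S, x * x = x

/-- A semigroup is semilattice indecomposable if all its semilattice homomorphic images are
trivial. (Every homomorphic image has an isomorphic copy in the universe of `S`.) -/
def IsSIndecomposable (S : Type u) [Semigroup S] : Prop :=
  ∀ (T : Type u) [Semigroup T] (f : S →ₙ* T),
    Function.Surjective f → IsSemilatticeSemigroup T → Subsingleton T

/-- `S` is `B₂`-combinatorial: it is semilattice indecomposable, `|S| = 4k + 1` for some natural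
number `k`, and `S` has a subsemilattice with `2k + 1` elements. -/
def IsB2Combinatorial (S : Type u) [Semigroup S] : Prop :=
  IsSIndecomposable S ∧
    ∃ k : ℕ, Nat.card S = 4 * k + 1 ∧
      ∃ Y : Subsemigroup S, IsSemilatticeSemigroup Y ∧ Nat.card Y = 2 * k + 1

/-- A (two-sided, nonempty) ideal of a semigroup. -/
structure IsSemigroupIdeal {S : Type u} [Semigroup S] (I : Set S) : Prop where
  nonempty : I.Nonempty
  mul_mem_left : ∀ (s : S) {x : S}, x ∈ I → s * x ∈ I
  mul_mem_right : ∀ {x : S} (s : S), x ∈ I → x * s ∈ I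

/-- An ideal, regarded as a semigroup under the multiplication of the ambient semigroup. -/
def IsSemigroupIdeal.toSubsemigroup {S : Type u} [Semigroup S] {I : Set S}
    (h : IsSemigroupIdeal I) : Subsemigroup S where
  carrier := I
  mul_mem' := fun {a _} _ hb => h.mul_mem_left a hb

/-!
The proof decomposes `S` into the classes of Green's relation `J` (`GreenLE`, `greenClass`).

Let `Y` be the given subsemilattice. In a finite semigroup two distinct commuting idempotents of one
`J`-class have their product in a lower class, so a class with `m` elements, `n` of them in `Y`,
satisfies `n ^ 2 ≤ m` (`sq_ncard_inter_le`). Hence `m - 2 * n ≥ -1`, with equality only for a class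
consisting of one idempotent. Since the sum of these numbers over all classes is
`(4k + 1) - 2(2k + 1) = -1`, some class has this form. Semilattice indecomposability enters through
`greenLE_of_mul_mem`: a class that contains an idempotent and is closed under multiplication is the
minimal ideal. So the one-element class is unique, it is a zero, and every other class has `m = 2n`;
the value `n = 1` gives a closed class and is excluded, so `m = 4` and `n = 2`. Such a class
multiplies like the matrix units of the Brandt semigroup `B₂` (`exists_isBrandtClass`). This is the
structure theorem `IsB2Combinatorial.exists_isB2Stratified`.

Conversely, a finite semigroup with this structure is `B₂`-combinatorial
(`IsB2Stratified.isB2Combinatorial`), and the structure passes to homomorphic images and to ideals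
(`IsB2Stratified.map`, `IsB2Stratified.ideal`). For the semigroup algebra, each of the `k` nonzero
classes carries a representation by `2 × 2` matrices (`IsBrandtClass.matrixRep`); these and the
trivial character, which belongs to the class of the zero, are jointly triangular with respect to
the `J`-order, so together they give the isomorphism.
-/

/-! ### Green's `J`-order on a semigroup -/

section GreenOrder

/-- Green's `J`-preorder: `GreenLE b a` says that `a` lies in the two-sided ideal generated by `b`,
that is, `a ≤ b` in the `J`-order. The larger element is the parameter, so that induction runs over
the multiplications that lead from `b` down to `a`. -/
inductive GreenLE {S : Type u} [Semigroup S] (b : S) : S → Prop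
  | refl : GreenLE b b
  | mul_left (s : S) {a : S} : GreenLE b a → GreenLE b (s * a)
  | mul_right {a : S} (s : S) : GreenLE b a → GreenLE b (a * s)

variable {S : Type u} [Semigroup S]

theorem GreenLE.trans {a b c : S} (hbc : GreenLE c b) (hab : GreenLE b a) : GreenLE c a := by
  induction hab with
  | refl => exact hbc
  | mul_left s _ ih => exact ih.mul_left s
  | mul_right s _ ih => exact ih.mul_right s

theorem greenLE_mul_left (s a : S) : GreenLE a (s * a) := .mul_left s .refl

theorem greenLE_mul_right (a s : S) : GreenLE a (a * s) := .mul_right s .refl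

theorem greenLE_mul_mul (s a t : S) : GreenLE a (s * a * t) := .mul_right t (.mul_left s .refl)

theorem GreenLE.exists_mul_mul {a b : S} (h : GreenLE b a) :
    ∀ c d : S, ∃ p q : S, c * a * d = p * b * q := by
  induction h with
  | refl => exact fun c d => ⟨c, d, rfl⟩
  | mul_left s _ ih => intro c d; simpa only [mul_assoc] using ih (c * s) d
  | mul_right s _ ih => intro c d; simpa only [mul_assoc] using ih c (s * d)

/-- An idempotent `e` below `b` factors as `p * b * q` with `p, q` in the semigroup itself (no unit
need be adjoined), and `p`, `q` can be chosen fixed by `e` on the outer side. -/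
theorem GreenLE.exists_eq_of_idempotent {e b : S} (h : GreenLE b e) (he : e * e = e) :
    ∃ p q : S, e = p * b * q ∧ e * p = p ∧ q * e = q := by
  obtain ⟨p, q, h⟩ := h.exists_mul_mul e e
  rw [he, he] at h
  refine ⟨e * p, q * e, ?_, by rw [← mul_assoc, he], by rw [mul_assoc, he]⟩
  calc e = e * e * e := by rw [he, he]
    _ = e * (p * b * q) * e := by rw [← h]
    _ = e * p * b * (q * e) := by simp only [mul_assoc]

theorem GreenLE.map {T : Type v} [Semigroup T] (f : S →ₙ* T) {a b : S} (h : GreenLE b a) :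
    GreenLE (f b) (f a) := by
  induction h with
  | refl => exact .refl
  | mul_left s _ ih => rw [map_mul]; exact ih.mul_left _
  | mul_right s _ ih => rw [map_mul]; exact ih.mul_right _

/-- Under a surjective homomorphism, anything below an image `f s` comes from below `s`. -/
theorem GreenLE.exists_lift {T : Type v} [Semigroup T] {f : S →ₙ* T} (hf : Function.Surjective f)
    {s : S} {t : T} (h : GreenLE (f s) t) : ∃ a, GreenLE s a ∧ f a = t := by
  induction h with
  | refl => exact ⟨s, .refl, rfl⟩
  | mul_left c _ ih =>
    obtain ⟨a, ha, rfl⟩ := ih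
    obtain ⟨c, rfl⟩ := hf c
    exact ⟨c * a, ha.mul_left c, map_mul f c a⟩
  | mul_right c _ ih =>
    obtain ⟨a, ha, rfl⟩ := ih
    obtain ⟨c, rfl⟩ := hf c
    exact ⟨a * c, ha.mul_right c, map_mul f a c⟩

variable (S) in
/-- The `J`-order as a `Preorder`, with `a ≤ b` meaning `GreenLE b a`. It is not an instance: it
gives finite semigroups access to the lemmas on minimal and maximal elements. -/
abbrev greenPreorder : Preorder S where
  le a b := GreenLE b a
  le_refl _ := .refl
  le_trans _ _ _ h₁ h₂ := h₂.trans h₁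

theorem exists_greenLE_minimal [Finite S] {A : Set S} (hA : A.Nonempty) :
    ∃ s ∈ A, ∀ t ∈ A, GreenLE s t → GreenLE t s := by
  let := greenPreorder S
  obtain ⟨s, hs⟩ := A.toFinite.exists_minimal hA
  exact ⟨s, hs.1, fun t ht h => hs.2 ht h⟩

theorem exists_greenLE_maximal [Finite S] {A : Set S} (hA : A.Nonempty) :
    ∃ s ∈ A, ∀ t ∈ A, GreenLE t s → GreenLE s t := by
  let := greenPreorder S
  obtain ⟨s, hs⟩ := A.toFinite.exists_maximal hA
  exact ⟨s, hs.1, fun t ht h => hs.2 ht h⟩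

variable (S) in
/-- Green's relation `J`: two elements are related if they generate the same two-sided ideal. -/
def greenSetoid : Setoid S where
  r a b := GreenLE a b ∧ GreenLE b a
  iseqv := ⟨fun _ => ⟨.refl, .refl⟩, fun h => ⟨h.2, h.1⟩,
    fun h₁ h₂ => ⟨h₁.1.trans h₂.1, h₂.2.trans h₁.2⟩⟩

/-- The `J`-class of an element. -/
def greenClass (s : S) : Set S := {t | GreenLE s t ∧ GreenLE t s}

theorem mem_greenClass_self (s : S) : s ∈ greenClass s := ⟨.refl, .refl⟩

theorem greenClass_eq {s t : S} (h : t ∈ greenClass s) : greenClass t = greenClass s :=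
  Set.ext fun _ => ⟨fun hr => ⟨h.1.trans hr.1, hr.2.trans h.2⟩,
    fun hr => ⟨h.2.trans hr.1, hr.2.trans h.1⟩⟩

theorem setOf_mk_eq (s : S) : {b | (⟦b⟧ : Quotient (greenSetoid S)) = ⟦s⟧} = greenClass s :=
  Set.ext fun _ => Quotient.eq.trans and_comm

/-- Some positive iterate of a self-map of a finite set is idempotent. -/
theorem exists_iterate_idempotent {X : Type u} [Finite X] (F : X → X) :
    ∃ n, 0 < n ∧ ∀ x, F^[n] (F^[n] x) = F^[n] x := by
  classical
  obtain ⟨m, n, hne, h⟩ := Finite.exists_ne_map_eq_of_infinite fun n : ℕ => F^[n]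
  wlog hmn : m < n generalizing m n
  · exact this n m hne.symm h.symm (by omega)
  obtain ⟨d, rfl⟩ := Nat.exists_eq_add_of_lt hmn
  have key : ∀ j k, m ≤ k → F^[k + j * (d + 1)] = F^[k] := by
    intro j
    induction j with
    | zero => simp
    | succ j ih =>
      intro k hk
      obtain ⟨c, rfl⟩ := Nat.exists_eq_add_of_le hk
      have : m + c + (j + 1) * (d + 1) = (c + (m + d + 1)) + j * (d + 1) := by ring
      rw [this, ih _ (by omega), Function.iterate_add]
      rw [← h, ← Function.iterate_add, add_comm]
  refine ⟨(m + 1) * (d + 1), by positivity, fun x => ?_⟩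
  rw [← Function.iterate_add_apply, key (m + 1) _ (by nlinarith)]

/-- Stability of finite semigroups, for idempotents: an idempotent `g ≤ f` that lies in the
`J`-class of `f` equals `f`. -/
theorem eq_of_idempotent_of_greenLE [Finite S] {f g : S} (hg : g * g = g)
    (hfg : f * g = g) (hgf : g * f = g) (h : GreenLE g f) (hf : f * f = f) : f = g := by
  obtain ⟨p, q, hpq, -, -⟩ := h.exists_eq_of_idempotent hf
  -- An idempotent power of left multiplication by `p * g` fixes `f`, whence `f` ends in `g`.
  obtain ⟨n, hn, hidem⟩ := exists_iterate_idempotent fun s => p * g * s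
  have hmul : ∀ (m : ℕ) (s t : S),
      (fun s => p * g * s)^[m] (s * t) = (fun s => p * g * s)^[m] s * t := by
    intro m
    induction m with
    | zero => intros; rfl
    | succ m ih => intro s t; simp only [Function.iterate_succ_apply, ← mul_assoc, ← ih]
  have hfix : p * g * f * q = f := by rw [mul_assoc p g f, hgf, ← hpq]
  have hiter : ∀ m : ℕ, ∃ r : S, (fun s => p * g * s)^[m] f * r = f := by
    intro m
    induction m with
    | zero => exact ⟨f, hf⟩
    | succ m ih =>
      obtain ⟨r, hr⟩ := ih
      refine ⟨q * r, ?_⟩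
      rw [Function.iterate_succ_apply, ← mul_assoc, ← hmul, hfix, hr]
  obtain ⟨r, hr⟩ := hiter n
  have hfixn : (fun s => p * g * s)^[n] f = f := by
    conv_lhs => rw [← hr]
    rw [hmul, hidem, hr]
  obtain ⟨m, rfl⟩ := Nat.exists_eq_succ_of_ne_zero hn.ne'
  rw [Function.iterate_succ_apply] at hfixn
  simp only [mul_assoc p g f, hgf] at hfixn
  rw [hmul] at hfixn
  have hfg' : f * g = f := by rw [← hfixn, mul_assoc, hg]
  rw [← hfg', hfg]

end GreenOrder

/-! ### Semilattice indecomposability -/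

/-- A semigroup is semilattice indecomposable iff it has no proper nonempty filter (a set that
contains a product exactly when it contains both factors). The right-hand side does not mention
other semigroups, hence is free of universe restrictions. -/
theorem isSIndecomposable_iff {S : Type u} [Semigroup S] :
    IsSIndecomposable S ↔ ∀ F : Set S, (∀ x y, x * y ∈ F ↔ x ∈ F ∧ y ∈ F) → F.Nonempty →
      F = Set.univ := by
  classical
  constructor
  · intro hS F hF hne
    by_contra hF'
    obtain ⟨a, ha⟩ := hne
    obtain ⟨b, hb⟩ := (Set.ne_univ_iff_exists_notMem F).1 hF'
    -- The multiplicative semigroup of `ZMod 2` is the two-element semilattice.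
    let f : S →ₙ* ULift.{u} (ZMod 2) :=
      { toFun := fun s => ⟨if s ∈ F then 1 else 0⟩
        map_mul' := fun x y => by
          ext1
          by_cases hx : x ∈ F <;> by_cases hy : y ∈ F <;> simp [hF, hx, hy] }
    have hsurj : Function.Surjective f := by
      rintro ⟨t⟩
      obtain rfl | rfl : t = 0 ∨ t = 1 := by revert t; decide
      · exact ⟨b, ULift.ext _ _ (if_neg hb)⟩
      · exact ⟨a, ULift.ext _ _ (if_pos ha)⟩
    have hsub := hS _ f hsurj
      ⟨mul_comm, fun x => ULift.ext _ _ ((by decide : ∀ t : ZMod 2, t * t = t) x.down)⟩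
    have : (ULift.up (0 : ZMod 2) : ULift.{u} (ZMod 2)) = ULift.up 1 := Subsingleton.elim _ _
    simp at this
  · intro hS T _ f hf hT
    -- The elements above `a` in the semilattice `T` pull back to a filter of `S`.
    have key : ∀ a x : T, x * a = a := by
      intro a x
      have h := hS {s | f s * a = a} (fun s t => ?_) (by
        obtain ⟨s, rfl⟩ := hf a
        exact ⟨s, hT.2 _⟩)
      · obtain ⟨s, rfl⟩ := hf x
        exact (Set.ext_iff.1 h s).2 trivial
      · simp only [Set.mem_ofPred_eq, map_mul]
        refine ⟨fun h => ⟨?_, ?_⟩, fun h => by rw [mul_assoc, h.2, h.1]⟩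
        · rw [← h, ← mul_assoc, ← mul_assoc, hT.2]
        · rw [← h, ← mul_assoc, hT.1 (f s), ← mul_assoc, hT.2]
    exact ⟨fun a b => by rw [← key b a, hT.1, key]⟩

/-! ### Semigroups whose nonzero `J`-classes are Brandt classes -/

section Brandt

variable {S : Type u} [Semigroup S]

/-- The `x i j` are exactly the elements of `C`, and they multiply like the matrix units of the
Brandt semigroup `B₂`, a product that would be zero in `B₂` being one that leaves `C`. Distinctness
of the four elements follows, see `IsBrandtClass.eq_iff`. -/
structure IsBrandtClass (C : Set S) (x : Fin 2 → Fin 2 → S) : Prop where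
  mem : ∀ i j, x i j ∈ C
  exists_eq : ∀ c ∈ C, ∃ i j, x i j = c
  mul_eq : ∀ i j l, x i j * x j l = x i l
  mul_notMem : ∀ i j k l, j ≠ k → x i j * x k l ∉ C

namespace IsBrandtClass

variable {C : Set S} {x : Fin 2 → Fin 2 → S}

theorem mul_mem_iff (h : IsBrandtClass C x) {i j k l : Fin 2} : x i j * x k l ∈ C ↔ j = k := by
  refine ⟨fun hm => by_contra fun hjk => h.mul_notMem i j k l hjk hm, ?_⟩
  rintro rfl
  rw [h.mul_eq]
  exact h.mem i l

theorem eq_iff (h : IsBrandtClass C x) {i j k l : Fin 2} : x i j = x k l ↔ i = k ∧ j = l := by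
  refine ⟨fun he => ⟨?_, ?_⟩, by rintro ⟨rfl, rfl⟩; rfl⟩
  · rw [← h.mul_mem_iff (i := i) (l := l), ← he, h.mul_mem_iff]
  · rw [← h.mul_mem_iff (i := i) (l := l), he, h.mul_mem_iff]

/-- The enumeration of a Brandt class by the positions of its matrix units. -/
noncomputable def equiv (h : IsBrandtClass C x) : Fin 2 × Fin 2 ≃ C :=
  Equiv.ofBijective (fun p => ⟨x p.1 p.2, h.mem p.1 p.2⟩)
    ⟨fun p q hpq => by
      have := h.eq_iff.1 (congrArg Subtype.val hpq)
      exact Prod.ext this.1 this.2,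
    fun c => by
      obtain ⟨i, j, hij⟩ := h.exists_eq c c.2
      exact ⟨(i, j), Subtype.ext hij⟩⟩

theorem ncard_eq (h : IsBrandtClass C x) : C.ncard = 4 := by
  rw [← Nat.card_coe_set_eq, ← Nat.card_congr h.equiv]
  simp

theorem eq_of_idempotent (h : IsBrandtClass C x) {i j : Fin 2} (he : x i j * x i j = x i j) :
    i = j := by
  have hm := h.mem i j
  rw [← he, h.mul_mem_iff] at hm
  exact hm.symm

theorem ncard_inter (h : IsBrandtClass C x) {Y : Set S} (hY : ∀ y ∈ Y, y * y = y)
    (hx : ∀ i, x i i ∈ Y) : (C ∩ Y).ncard = 2 := by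
  have : C ∩ Y = {x 0 0, x 1 1} := by
    ext c
    simp only [Set.mem_inter_iff, Set.mem_insert_iff, Set.mem_singleton_iff]
    constructor
    · rintro ⟨hC, hc⟩
      obtain ⟨i, j, rfl⟩ := h.exists_eq c hC
      obtain rfl := h.eq_of_idempotent (hY _ hc)
      obtain rfl | rfl : i = 0 ∨ i = 1 := by omega
      · exact .inl rfl
      · exact .inr rfl
    · rintro (rfl | rfl)
      · exact ⟨h.mem _ _, hx _⟩
      · exact ⟨h.mem _ _, hx _⟩
  rw [this, Set.ncard_pair]
  rw [Ne, h.eq_iff]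
  decide

end IsBrandtClass

/-- `z` is a zero lying in the subsemilattice `Y`, and the `J`-class of every nonzero element is a
Brandt class whose two idempotents lie in `Y`. This is the structural description of
`B₂`-combinatorial semigroups. -/
structure IsB2Stratified (Y : Subsemigroup S) (z : S) : Prop where
  semilattice : IsSemilatticeSemigroup Y
  zero_mul : ∀ s, z * s = z
  mul_zero : ∀ s, s * z = z
  zero_mem : z ∈ Y
  exists_brandt : ∀ s, s ≠ z → ∃ x, IsBrandtClass (greenClass s) x ∧ ∀ i, x i i ∈ Y

namespace IsB2Stratified

variable {Y : Subsemigroup S} {z : S}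

theorem greenLE_zero (h : IsB2Stratified Y z) (s : S) : GreenLE s z := by
  rw [← h.mul_zero s]
  exact greenLE_mul_right s z

theorem eq_zero_of_greenLE (h : IsB2Stratified Y z) {s : S} (hs : GreenLE z s) : s = z := by
  induction hs with
  | refl => rfl
  | mul_left s _ ih => rw [ih, h.mul_zero]
  | mul_right s _ ih => rw [ih, h.zero_mul]

theorem greenClass_zero (h : IsB2Stratified Y z) : greenClass z = {z} := by
  ext s
  constructor
  · exact fun hs => h.eq_zero_of_greenLE hs.1
  · rintro rfl
    exact mem_greenClass_self s

/-- A `J`-minimal element of a filter is zero: the filter contains both idempotents of a Brandt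
class that it meets, hence also their product, which lies strictly below. -/
theorem isSIndecomposable [Finite S] (h : IsB2Stratified Y z) : IsSIndecomposable S := by
  rw [isSIndecomposable_iff]
  intro F hF hne
  suffices hz : z ∈ F by
    refine Set.eq_univ_of_forall fun s => ?_
    exact ((hF z s).1 (by rwa [h.zero_mul])).2
  obtain ⟨s, hs, hmin⟩ := exists_greenLE_minimal hne
  by_contra hz
  obtain ⟨x, hx, -⟩ := h.exists_brandt s (by rintro rfl; exact hz hs)
  have hall : ∀ i j, x i j ∈ F := by
    obtain ⟨i, j, rfl⟩ := hx.exists_eq s (mem_greenClass_self s)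
    have hj : ∀ k, x j k ∈ F ∧ x k j ∈ F := fun k => by
      rw [← hF, hx.mul_eq]
      exact ((hF _ _).1 (by rwa [hx.mul_eq i j j])).2
    intro k l
    rw [← hx.mul_eq k j l, hF]
    exact ⟨(hj k).2, (hj l).1⟩
  have hprod : x 0 0 * x 1 1 ∈ F := (hF _ _).2 ⟨hall _ _, hall _ _⟩
  have hle : GreenLE s (x 0 0 * x 1 1) := (hx.mem 0 0).1.mul_right _
  exact hx.mul_notMem 0 0 1 1 (by decide) ⟨hle, hmin _ hprod hle⟩

end IsB2Stratified

end Brandt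

/-! ### Counting over the classes of an equivalence relation -/

section Counting

theorem sum_ncard_quotient {X : Type u} [Finite X] (r : Setoid X) [Fintype (Quotient r)]
    (P : Set X) : ∑ q : Quotient r, ({b | ⟦b⟧ = q} ∩ P).ncard = P.ncard := by
  classical
  have := Fintype.ofFinite X
  rw [Set.ncard_eq_toFinset_card' P,
    Finset.card_eq_sum_card_fiberwise (f := fun a => (⟦a⟧ : Quotient r)) (t := Finset.univ)
      (fun _ _ => Finset.mem_coe.2 (Finset.mem_univ _))]
  refine Finset.sum_congr rfl fun q _ => ?_
  rw [Set.ncard_eq_toFinset_card']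
  congr 1
  ext b
  simp only [Finset.mem_filter, Set.mem_toFinset, Set.mem_inter_iff, Set.mem_ofPred_eq, and_comm]

/-- If `P` has one element in the class of `z` and `c` elements in every other class, then it has
`c * k + 1` elements, where `k` is the number of other classes. -/
theorem ncard_eq_of_setoid {X : Type u} [Finite X] (r : Setoid X) (z : X) (P : Set X) (c : ℕ)
    (hz : ({b | (⟦b⟧ : Quotient r) = ⟦z⟧} ∩ P).ncard = 1)
    (hc : ∀ a, (⟦a⟧ : Quotient r) ≠ ⟦z⟧ → ({b | (⟦b⟧ : Quotient r) = ⟦a⟧} ∩ P).ncard = c) :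
    P.ncard = c * Nat.card {q : Quotient r // q ≠ ⟦z⟧} + 1 := by
  classical
  have := Fintype.ofFinite (Quotient r)
  rw [← sum_ncard_quotient r P, ← Finset.sum_erase_add _ _ (Finset.mem_univ (⟦z⟧ : Quotient r)),
    hz, Finset.sum_const_nat (m := c), mul_comm, Nat.card_eq_fintype_card, Fintype.card_subtype]
  · congr 3
    ext q
    simp
  · intro q hq
    induction q using Quotient.inductionOn with | _ a =>
    exact hc a (Finset.ne_of_mem_erase hq)

end Counting

/-! ### Cardinalities, homomorphic images and ideals of stratified semigroups -/

namespace IsB2Stratified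

variable {S : Type u} [Semigroup S] {Y : Subsemigroup S} {z : S}

theorem natCard_eq [Finite S] (h : IsB2Stratified Y z) :
    Nat.card S = 4 * Nat.card {q : Quotient (greenSetoid S) // q ≠ ⟦z⟧} + 1 := by
  rw [← Set.ncard_univ]
  refine ncard_eq_of_setoid (greenSetoid S) z Set.univ 4 ?_ fun a ha => ?_
  · rw [Set.inter_univ, setOf_mk_eq, h.greenClass_zero, Set.ncard_singleton]
  · obtain ⟨x, hx, -⟩ := h.exists_brandt a fun haz => ha (by rw [haz])
    rw [Set.inter_univ, setOf_mk_eq, hx.ncard_eq]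

theorem natCard_semilattice_eq [Finite S] (h : IsB2Stratified Y z) :
    Nat.card Y = 2 * Nat.card {q : Quotient (greenSetoid S) // q ≠ ⟦z⟧} + 1 := by
  rw [← SetLike.coe_sort_coe, Nat.card_coe_set_eq]
  refine ncard_eq_of_setoid (greenSetoid S) z (Y : Set S) 2 ?_ fun a ha => ?_
  · rw [setOf_mk_eq, h.greenClass_zero, Set.singleton_inter_of_mem h.zero_mem,
      Set.ncard_singleton]
  · obtain ⟨x, hx, hxY⟩ := h.exists_brandt a fun haz => ha (by rw [haz])
    rw [setOf_mk_eq]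
    exact hx.ncard_inter (fun y hy => congrArg Subtype.val (h.semilattice.2 ⟨y, hy⟩)) hxY

theorem isB2Combinatorial [Finite S] (h : IsB2Stratified Y z) : IsB2Combinatorial S :=
  ⟨h.isSIndecomposable, _, h.natCard_eq, Y, h.semilattice, h.natCard_semilattice_eq⟩

/-- A `J`-class of the image is the image of a `J`-minimal class among those mapped into it. By
minimality, products that leave the upstairs class are also sent out of the downstairs class, so the
image of the matrix units is again a system of matrix units. -/
theorem map [Finite S] {T : Type v} [Semigroup T] (h : IsB2Stratified Y z) (f : S →ₙ* T)
    (hf : Function.Surjective f) : IsB2Stratified (Y.map f) (f z) where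
  semilattice := by
    constructor
    · rintro ⟨_, a, ha, rfl⟩ ⟨_, b, hb, rfl⟩
      have := congrArg Subtype.val (h.semilattice.1 ⟨a, ha⟩ ⟨b, hb⟩)
      exact Subtype.ext (by simpa using congrArg f this)
    · rintro ⟨_, a, ha, rfl⟩
      have := congrArg Subtype.val (h.semilattice.2 ⟨a, ha⟩)
      exact Subtype.ext (by simpa using congrArg f this)
  zero_mul t := by
    obtain ⟨s, rfl⟩ := hf t
    rw [← map_mul, h.zero_mul]
  mul_zero t := by
    obtain ⟨s, rfl⟩ := hf t
    rw [← map_mul, h.mul_zero]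
  zero_mem := ⟨z, h.zero_mem, rfl⟩
  exists_brandt t ht := by
    obtain ⟨s, hs, hmin⟩ := exists_greenLE_minimal (A := f ⁻¹' greenClass t) (by
      obtain ⟨s, rfl⟩ := hf t
      exact ⟨s, mem_greenClass_self _⟩)
    have hst : greenClass (f s) = greenClass t := greenClass_eq hs
    have hsz : s ≠ z := by
      rintro rfl
      obtain ⟨a, ha, rfl⟩ := hs.2.exists_lift hf
      exact ht (by rw [h.eq_zero_of_greenLE ha])
    obtain ⟨x, hx, hxY⟩ := h.exists_brandt s hsz
    have hmem : ∀ {a}, a ∈ greenClass s → f a ∈ greenClass t := fun ha => by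
      rw [← hst]
      exact ⟨ha.1.map f, ha.2.map f⟩
    refine ⟨fun i j => f (x i j), ⟨fun i j => hmem (hx.mem i j), ?_, ?_, ?_⟩,
      fun i => ⟨_, hxY i, rfl⟩⟩
    · intro c hc
      obtain ⟨a, ha, rfl⟩ := GreenLE.exists_lift hf (hst ▸ hc : c ∈ greenClass (f s)).1
      obtain ⟨i, j, rfl⟩ := hx.exists_eq a ⟨ha, hmin a hc ha⟩
      exact ⟨i, j, rfl⟩
    · intro i j l
      rw [← map_mul, hx.mul_eq]
    · intro i j k l hjk hm
      rw [← map_mul] at hm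
      have hle : GreenLE s (x i j * x k l) := (hx.mem i j).1.mul_right _
      exact hx.mul_notMem i j k l hjk ⟨hle, hmin _ hm hle⟩

/-- The `J`-classes of an ideal, computed inside the ideal, are `J`-classes of the whole semigroup,
because matrix units can be transformed into each other inside their own class. -/
theorem ideal (h : IsB2Stratified Y z) {I : Set S} (hI : IsSemigroupIdeal I) :
    ∃ z', IsB2Stratified (Y.comap (MulMemClass.subtype hI.toSubsemigroup)) z' := by
  have hzI : z ∈ I := by
    obtain ⟨s, hs⟩ := hI.nonempty
    rw [← h.zero_mul s]
    exact hI.mul_mem_left z hs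
  have hle : ∀ {a b : S}, a ∈ I → GreenLE a b → b ∈ I := by
    intro a b ha hab
    induction hab with
    | refl => exact ha
    | mul_left s _ ih => exact hI.mul_mem_left s ih
    | mul_right s _ ih => exact hI.mul_mem_right s ih
  refine ⟨⟨z, hzI⟩, ?_, fun s => Subtype.ext (h.zero_mul s), fun s => Subtype.ext (h.mul_zero s),
    h.zero_mem, ?_⟩
  · constructor
    · intro a b
      have := congrArg Subtype.val (h.semilattice.1 ⟨_, a.2⟩ ⟨_, b.2⟩)
      exact Subtype.ext (Subtype.ext this)
    · intro a
      have := congrArg Subtype.val (h.semilattice.2 ⟨_, a.2⟩)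
      exact Subtype.ext (Subtype.ext this)
  · intro s hs
    obtain ⟨x, hx, hxY⟩ := h.exists_brandt s fun hsz => hs (Subtype.ext hsz)
    let y : Fin 2 → Fin 2 → hI.toSubsemigroup := fun i j => ⟨x i j, hle s.2 (hx.mem i j).1⟩
    have hyy : ∀ i j l, y i j * y j l = y i l := fun i j l => Subtype.ext (hx.mul_eq i j l)
    have hyle : ∀ i j k l, GreenLE (y i j) (y k l) := fun i j k l => by
      rw [← hyy k i l, ← hyy i j l, ← mul_assoc]
      exact greenLE_mul_mul _ _ _
    obtain ⟨a, b, hab⟩ := hx.exists_eq s (mem_greenClass_self _)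
    have hys : y a b = s := Subtype.ext hab
    have hsub : ∀ {t}, t ∈ greenClass s → (t : S) ∈ greenClass (s : S) := fun ht =>
      ⟨ht.1.map (MulMemClass.subtype hI.toSubsemigroup),
        ht.2.map (MulMemClass.subtype hI.toSubsemigroup)⟩
    refine ⟨y, ⟨fun i j => hys ▸ ⟨hyle _ _ _ _, hyle _ _ _ _⟩, ?_, hyy, ?_⟩, hxY⟩
    · intro c hc
      obtain ⟨i, j, hij⟩ := hx.exists_eq c (hsub hc)
      exact ⟨i, j, Subtype.ext hij⟩
    · exact fun i j k l hjk hm => hx.mul_notMem i j k l hjk (hsub hm)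

end IsB2Stratified

/-! ### The structure of `B₂`-combinatorial semigroups -/

section Extremal

variable {S : Type u} [Semigroup S]

/-- If an idempotent `e` lies below an idempotent `f`, there are `x ∈ eSf` and `y ∈ fSe` with
`x * y = e`. -/
theorem exists_transition {e f : S} (he : e * e = e) (hf : f * f = f) (h : GreenLE f e) :
    ∃ x y : S, x * y = e ∧ e * x = x ∧ x * f = x ∧ f * y = y ∧ y * e = y := by
  obtain ⟨p, q, hpq, hp, hq⟩ := h.exists_eq_of_idempotent he
  refine ⟨p * f, f * q, ?_, ?_, ?_, ?_, ?_⟩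
  · rw [mul_assoc, ← mul_assoc f, hf, ← mul_assoc, ← hpq]
  · rw [← mul_assoc, hp]
  · rw [mul_assoc, hf]
  · rw [← mul_assoc, hf]
  · rw [mul_assoc, hq]

/-- The product of two distinct commuting idempotents of a `J`-class leaves the class. -/
theorem mul_notMem_greenClass [Finite S] {s e f : S} (he : e * e = e) (hf : f * f = f)
    (hef : e * f = f * e) (hne : e ≠ f) (hes : e ∈ greenClass s) (hfs : f ∈ greenClass s) :
    e * f ∉ greenClass s := by
  intro h
  have hg : e * f * (e * f) = e * f := by
    rw [mul_assoc, ← mul_assoc f, ← hef, mul_assoc e f f, hf, ← mul_assoc, he]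
  have h₁ : e = e * f := eq_of_idempotent_of_greenLE hg (by rw [← mul_assoc, he])
    (by rw [mul_assoc, ← hef, ← mul_assoc, he]) (h.2.trans hes.1) he
  have h₂ : f = e * f := eq_of_idempotent_of_greenLE hg
    (by rw [hef, ← mul_assoc, hf]) (by rw [mul_assoc, hf]) (h.2.trans hfs.1) hf
  exact hne (h₁.trans h₂.symm)

/-- A `J`-class with `n` elements in a subsemilattice has at least `n ^ 2` elements: for idempotents
`e, f` of the class it contains some `x = e * x = x * f`, and `x` determines `e` and `f`. -/
theorem sq_ncard_inter_le [Finite S] {Y : Subsemigroup S} (hY : IsSemilatticeSemigroup Y) (s : S) :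
    (greenClass s ∩ Y).ncard ^ 2 ≤ (greenClass s).ncard := by
  have hidem : ∀ y ∈ Y, y * y = y := fun y hy => congrArg Subtype.val (hY.2 ⟨y, hy⟩)
  have hcomm : ∀ a ∈ Y, ∀ b ∈ Y, a * b = b * a := fun a ha b hb =>
    congrArg Subtype.val (hY.1 ⟨a, ha⟩ ⟨b, hb⟩)
  have hex : ∀ p : ↥(greenClass s ∩ Y) × ↥(greenClass s ∩ Y),
      ∃ x ∈ greenClass s, p.1 * x = x ∧ x * p.2 = x := by
    rintro ⟨⟨e, he, heY⟩, f, hf, hfY⟩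
    obtain ⟨x, y, hxy, hex, hxf, -, -⟩ := exists_transition (hidem e heY) (hidem f hfY)
      (hf.2.trans he.1)
    refine ⟨x, ⟨?_, ?_⟩, hex, hxf⟩
    · rw [← hex]
      exact he.1.mul_right x
    · refine GreenLE.trans ?_ he.2
      rw [← hxy]
      exact greenLE_mul_right x y
  choose x hxs hx₁ hx₂ using hex
  have heq : ∀ e f c : S, e ∈ greenClass s ∩ Y → f ∈ greenClass s ∩ Y → c ∈ greenClass s →
      GreenLE (e * f) c → e = f := by
    intro e f c he hf hc hle
    by_contra hne
    exact mul_notMem_greenClass (hidem e he.2) (hidem f hf.2) (hcomm e he.2 f hf.2) hne he.1 hf.1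
      ⟨he.1.1.mul_right f, hle.trans hc.2⟩
  rw [sq, ← Nat.card_coe_set_eq, ← Nat.card_coe_set_eq, ← Nat.card_prod]
  refine Nat.card_le_card_of_injective (fun p => (⟨x p, hxs p⟩ : greenClass s)) fun p q hpq => ?_
  have hpq : x p = x q := congrArg Subtype.val hpq
  refine Prod.ext (Subtype.ext (heq _ _ _ p.1.2 q.1.2 (hxs p) ?_))
    (Subtype.ext (heq _ _ _ p.2.2 q.2.2 (hxs p) ?_))
  · have h : (p.1 : S) * q.1 * x p = x p := by rw [mul_assoc, hpq, hx₁ q, ← hpq, hx₁ p]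
    rw [← h]
    exact greenLE_mul_right _ _
  · have h : x p * ((p.2 : S) * q.2) = x p := by rw [← mul_assoc, hx₂ p, hpq, hx₂ q]
    rw [← h]
    exact greenLE_mul_left _ _

/-- In a semilattice indecomposable semigroup, a `J`-class that contains an idempotent and is closed
under multiplication is the minimal ideal: the elements above it form a filter. -/
theorem greenLE_of_mul_mem (hS : IsSIndecomposable S) {e : S} (he : e * e = e)
    (hcl : ∀ a ∈ greenClass e, ∀ b ∈ greenClass e, a * b ∈ greenClass e) (s : S) :
    GreenLE s e := by
  have h := isSIndecomposable_iff.1 hS {s | GreenLE s e}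
    (fun x y => ⟨fun h => ⟨(greenLE_mul_right x y).trans h, (greenLE_mul_left x y).trans h⟩, ?_⟩)
    ⟨e, .refl⟩
  · exact (Set.ext_iff.1 h s).2 trivial
  · rintro ⟨hx, hy⟩
    obtain ⟨a, b, hab, ha, hb⟩ := GreenLE.exists_eq_of_idempotent hx he
    obtain ⟨c, d, hcd, hc, hd⟩ := GreenLE.exists_eq_of_idempotent hy he
    have h₁ : b * a * x ∈ greenClass e := by
      constructor
      · rw [← hb]
        exact ((greenLE_mul_left b e).mul_right a).mul_right x
      · have : a * x * (b * a * x) * b = e := by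
          rw [show a * x * (b * a * x) * b = a * x * b * (a * x * b) by simp only [mul_assoc],
            ← hab, he]
        rw [← this]
        exact greenLE_mul_mul _ _ _
    have h₂ : y * d * c ∈ greenClass e := by
      constructor
      · rw [← hc, ← mul_assoc]
        exact (greenLE_mul_left (y * d) e).mul_right c
      · have : c * (y * d * c) * (y * d) = e := by
          rw [show c * (y * d * c) * (y * d) = c * y * d * (c * y * d) by simp only [mul_assoc],
            ← hcd, he]
        rw [← this]
        exact greenLE_mul_mul _ _ _
    refine GreenLE.trans ?_ (hcl _ h₁ _ h₂).2
    rw [show b * a * x * (y * d * c) = b * a * (x * y) * (d * c) by simp only [mul_assoc]]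
    exact greenLE_mul_mul _ _ _

/-- A two-element `J`-class with an idempotent is a subsemigroup (a left zero band, a right zero band
or a group). -/
theorem mul_mem_greenClass_of_ncard_two {e : S} (he : e * e = e)
    (hcard : (greenClass e).ncard = 2) :
    ∀ a ∈ greenClass e, ∀ b ∈ greenClass e, a * b ∈ greenClass e := by
  obtain ⟨g, hge, hC⟩ : ∃ g, g ≠ e ∧ greenClass e = {e, g} := by
    obtain ⟨a, b, hab, hC⟩ := Set.ncard_eq_two.1 hcard
    have := hC ▸ mem_greenClass_self e
    rcases this with rfl | rfl
    · exact ⟨b, hab.symm, hC⟩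
    · exact ⟨a, hab, by rw [hC, Set.pair_comm]⟩
  have hg : g ∈ greenClass e := by simp [hC]
  have hmem : ∀ a, GreenLE e a → GreenLE a e → a = e ∨ a = g := fun a h₁ h₂ => by
    simpa [hC] using (show a ∈ greenClass e from ⟨h₁, h₂⟩)
  suffices h : GreenLE (e * g) e ∧ GreenLE (g * e) e ∧ GreenLE (g * g) e by
    have hcl : ∀ a ∈ greenClass e, ∀ b ∈ greenClass e, GreenLE (a * b) e := by
      intro a ha b hb
      rw [hC] at ha hb
      rcases ha with rfl | rfl <;> rcases hb with rfl | rfl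
      · rw [he]; exact .refl
      · exact h.1
      · exact h.2.1
      · exact h.2.2
    exact fun a ha b hb => ⟨ha.1.mul_right b, hcl a ha b hb⟩
  obtain ⟨p, q, hpq, hp, hq⟩ := hg.2.exists_eq_of_idempotent he
  have of_idem : g * g = g → GreenLE (e * g) e ∧ GreenLE (g * e) e ∧ GreenLE (g * g) e := by
    intro hgg
    have hpg : p * g = e ∨ p * g = g := hmem _ (hg.1.mul_left p) (by
      conv_rhs => rw [hpq]
      exact greenLE_mul_right _ _)
    have hgg' : GreenLE (g * g) e := hgg.symm ▸ hg.2
    rcases hpg with h | h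
    · have heg : e * g = e := by rw [← h, mul_assoc, hgg]
      refine ⟨heg.symm ▸ .refl, ?_, hgg'⟩
      have : e * (g * e) = e := by rw [← mul_assoc, heg, he]
      conv_rhs => rw [← this]
      exact greenLE_mul_left _ _
    · have hge : g * e = e := by rw [hpq, h, ← mul_assoc, hgg]
      refine ⟨?_, hge.symm ▸ .refl, hgg'⟩
      have : e * g * e = e := by rw [mul_assoc, hge, he]
      conv_rhs => rw [← this]
      exact greenLE_mul_right _ _
  -- `g * q * p` and `q * p * g` are idempotents of the class. Either one of them is `g`, or both
  -- are `e`, which makes `g` invertible with respect to `e`.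
  have h₁ : g * q * p = e ∨ g * q * p = g := by
    refine hmem _ ((hg.1.mul_right q).mul_right p) ?_
    have : p * (g * q * p) * (g * q) = e := by
      rw [show p * (g * q * p) * (g * q) = p * g * q * (p * g * q) by simp only [mul_assoc],
        ← hpq, he]
    conv_rhs => rw [← this]
    exact greenLE_mul_mul _ _ _
  have h₂ : q * p * g = e ∨ q * p * g = g := by
    refine hmem _ (hg.1.mul_left (q * p)) ?_
    have : p * g * (q * p * g) * q = e := by
      rw [show p * g * (q * p * g) * q = p * g * q * (p * g * q) by simp only [mul_assoc],
        ← hpq, he]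
    conv_rhs => rw [← this]
    exact greenLE_mul_mul _ _ _
  rcases h₁ with h₁ | h₁
  · rcases h₂ with h₂ | h₂
    · refine ⟨?_, ?_, ?_⟩
      · have : e * g * (q * p) = e := by rw [mul_assoc, ← mul_assoc g, h₁, he]
        conv_rhs => rw [← this]
        exact greenLE_mul_right _ _
      · have : q * p * (g * e) = e := by rw [← mul_assoc, h₂, he]
        conv_rhs => rw [← this]
        exact greenLE_mul_left _ _
      · have : q * p * (g * g) * (q * p) = e := by
          rw [show q * p * (g * g) * (q * p) = q * p * g * (g * q * p) by simp only [mul_assoc],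
            h₁, h₂, he]
        conv_rhs => rw [← this]
        exact greenLE_mul_mul _ _ _
    · refine of_idem ?_
      conv_lhs => rw [← h₂]
      rw [show q * p * g * (q * p * g) = q * (p * g * q) * p * g by simp only [mul_assoc], ← hpq,
        hq, h₂]
  · refine of_idem ?_
    conv_lhs => rw [← h₁]
    rw [show g * q * p * (g * q * p) = g * (q * (p * g * q)) * p by simp only [mul_assoc], ← hpq,
      hq, h₁]

/-- A `J`-class with four elements, two of them distinct commuting idempotents, is a Brandt class. -/
theorem exists_isBrandtClass [Finite S] {s e f : S} (he : e * e = e) (hf : f * f = f)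
    (hef : e * f = f * e) (hne : e ≠ f) (hes : e ∈ greenClass s) (hfs : f ∈ greenClass s)
    (hcard : (greenClass s).ncard = 4) :
    ∃ x, IsBrandtClass (greenClass s) x ∧ x 0 0 = e ∧ x 1 1 = f := by
  have hprod := mul_notMem_greenClass he hf hef hne hes hfs
  obtain ⟨u, v, huv, heu, huf, hfv, hve⟩ := exists_transition he hf (hfs.2.trans hes.1)
  have hu : u ∈ greenClass s := by
    refine ⟨by rw [← heu]; exact hes.1.mul_right u, GreenLE.trans ?_ hes.2⟩
    rw [← huv]
    exact greenLE_mul_right _ _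
  have hv : v ∈ greenClass s := by
    refine ⟨by rw [← hfv]; exact hfs.1.mul_right v, GreenLE.trans ?_ hes.2⟩
    rw [← huv]
    exact greenLE_mul_left _ _
  have hvu : v * u = f := by
    symm
    refine eq_of_idempotent_of_greenLE ?_ (by rw [← mul_assoc, hfv]) (by rw [mul_assoc, huf]) ?_ hf
    · rw [mul_assoc, ← mul_assoc u, huv, heu]
    · refine GreenLE.trans ?_ (hes.2.trans hfs.1)
      have : u * (v * u) * v = e := by rw [← mul_assoc, huv, heu, huv]
      conv_rhs => rw [← this]
      exact greenLE_mul_mul _ _ _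
  let x : Fin 2 → Fin 2 → S := ![![e, u], ![v, f]]
  have hmem : ∀ i j, x i j ∈ greenClass s := by
    simp only [Fin.forall_fin_two]
    exact ⟨⟨hes, hu⟩, hv, hfs⟩
  have hmul : ∀ i j l, x i j * x j l = x i l := by
    simp only [Fin.forall_fin_two]
    exact ⟨⟨⟨he, heu⟩, huv, huf⟩, ⟨hve, hvu⟩, hfv, hf⟩
  have hnot : ∀ i j k l, j ≠ k → x i j * x k l ∉ greenClass s := by
    intro i j k l hjk hm
    have hmid : x j j * x k k = e * f := by
      obtain ⟨rfl, rfl⟩ | ⟨rfl, rfl⟩ : j = 0 ∧ k = 1 ∨ j = 1 ∧ k = 0 := by omega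
      · rfl
      · exact hef.symm
    rw [← hmul i j j, ← hmul k k l, show x i j * x j j * (x k k * x k l) =
      x i j * (x j j * x k k) * x k l by simp only [mul_assoc], hmid] at hm
    exact hprod ⟨hes.1.mul_right f, (greenLE_mul_mul _ _ _).trans hm.2⟩
  let C : Set S := Set.range fun p : Fin 2 × Fin 2 => x p.1 p.2
  have hsub : C ⊆ greenClass s := by
    rintro _ ⟨p, rfl⟩
    exact hmem _ _
  have hx : IsBrandtClass C x := ⟨fun i j => ⟨(i, j), rfl⟩,
    fun c ⟨p, hp⟩ => ⟨p.1, p.2, hp⟩, hmul, fun i j k l hjk hm => hnot i j k l hjk (hsub hm)⟩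
  have hCeq : C = greenClass s :=
    Set.eq_of_subset_of_ncard_le hsub (by rw [hx.ncard_eq, hcard]) (Set.toFinite _)
  exact ⟨x, hCeq ▸ hx, rfl, rfl⟩

/-- Write `m` for the size of a `J`-class and `n` for the size of its intersection with `Y`. The
numbers `m - 2 * n` add up to `-1`, and `n ^ 2 ≤ m` makes each of them at least `-1`, with equality
only for `m = n = 1`. Such a class is the minimal ideal, so it occurs exactly once, and all
other classes have `m = 2 * n`. Then `(m, n)` is `(4, 2)`, a Brandt class, or `(2, 1)`, which is
impossible because that class would again be the minimal ideal. -/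
theorem IsB2Combinatorial.exists_isB2Stratified (hS : IsB2Combinatorial S) :
    ∃ (Y : Subsemigroup S) (z : S), IsB2Stratified Y z := by
  classical
  obtain ⟨hSI, k, hk, Y, hY, hYk⟩ := hS
  have : Finite S := Nat.finite_of_card_ne_zero (by omega)
  have := Fintype.ofFinite (Quotient (greenSetoid S))
  have hidem : ∀ y ∈ Y, y * y = y := fun y hy => congrArg Subtype.val (hY.2 ⟨y, hy⟩)
  have hcomm : ∀ a ∈ Y, ∀ b ∈ Y, a * b = b * a := fun a ha b hb =>
    congrArg Subtype.val (hY.1 ⟨a, ha⟩ ⟨b, hb⟩)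
  -- The excess `m - 2 * n` of a class.
  let c : Quotient (greenSetoid S) → ℤ := fun q =>
    ({b | ⟦b⟧ = q} : Set S).ncard - 2 * (({b | ⟦b⟧ = q} : Set S) ∩ Y).ncard
  have hc : ∀ s : S, c (⟦s⟧) = (greenClass s).ncard - 2 * (greenClass s ∩ Y).ncard := fun s => by
    simp only [c, setOf_mk_eq]
  have hsum : ∑ q, c q = -1 := by
    have h₁ := sum_ncard_quotient (greenSetoid S) Set.univ
    have h₂ := sum_ncard_quotient (greenSetoid S) (Y : Set S)
    rw [Set.ncard_univ, hk] at h₁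
    rw [← Nat.card_coe_set_eq, SetLike.coe_sort_coe, hYk] at h₂
    simp only [Set.inter_univ] at h₁
    simp only [c, Finset.sum_sub_distrib, ← Finset.mul_sum, ← Nat.cast_sum, h₁, h₂]
    push_cast
    ring
  have hmin_of_neg : ∀ s, c (⟦s⟧) < 0 → c (⟦s⟧) = -1 ∧ s ∈ Y ∧ greenClass s = {s} := by
    intro s hs
    have hsq := sq_ncard_inter_le hY s
    rw [hc] at hs ⊢
    have hn : (greenClass s ∩ Y).ncard = 1 := by zify at *; nlinarith
    have hm : (greenClass s).ncard = 1 := by rw [hn] at hs hsq; omega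
    obtain ⟨a, ha⟩ := Set.ncard_eq_one.1 hm
    obtain rfl : s = a := by simpa [ha] using mem_greenClass_self s
    obtain ⟨b, hb⟩ := Set.ncard_eq_one.1 hn
    have hbs : b ∈ greenClass s ∩ Y := by simp [hb]
    obtain rfl : b = s := by simpa [ha] using hbs.1
    exact ⟨by rw [hn, hm]; norm_num, hbs.2, ha⟩
  obtain ⟨z, hz⟩ : ∃ z, c (⟦z⟧) < 0 := by
    by_contra! h
    have := Finset.sum_nonneg fun q (_ : q ∈ Finset.univ) => Quotient.inductionOn q h
    omega
  obtain ⟨hcz, hzY, hzC⟩ := hmin_of_neg z hz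
  have hzle : ∀ s, GreenLE s z := greenLE_of_mul_mem hSI (hidem z hzY) (by
    rw [hzC]
    rintro _ rfl _ rfl
    exact hidem _ hzY)
  have hzeq : ∀ s, GreenLE z s → s = z := fun s hs => by
    simpa [hzC] using (show s ∈ greenClass z from ⟨hs, hzle s⟩)
  have hnonneg : ∀ s, s ≠ z → 0 ≤ c (⟦s⟧) := by
    intro s hs
    by_contra! h
    obtain ⟨-, hsY, hsC⟩ := hmin_of_neg s h
    refine hs (hzeq s (greenLE_of_mul_mem hSI (hidem s hsY) ?_ z))
    rw [hsC]
    rintro _ rfl _ rfl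
    exact hidem _ hsY
  have hzero : ∀ s, s ≠ z → c (⟦s⟧) = 0 := by
    have hne : ∀ {s}, (⟦s⟧ : Quotient (greenSetoid S)) ≠ ⟦z⟧ ↔ s ≠ z := fun {s} =>
      not_congr ⟨fun h => hzeq s (Quotient.exact h).2, fun h => by rw [h]⟩
    rw [← Finset.sum_erase_add _ _ (Finset.mem_univ ⟦z⟧), hcz, add_eq_right,
      Finset.sum_eq_zero_iff_of_nonneg] at hsum
    · exact fun s hs => hsum _ (Finset.mem_erase.2 ⟨hne.2 hs, Finset.mem_univ _⟩)
    · intro q hq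
      induction q using Quotient.inductionOn with | _ s =>
      exact hnonneg s (hne.1 (Finset.ne_of_mem_erase hq))
  refine ⟨Y, z, hY, fun s => hzeq _ (greenLE_mul_right z s), fun s => hzeq _ (greenLE_mul_left s z),
    hzY, fun s hs => ?_⟩
  have hs0 := hzero s hs
  have hsq := sq_ncard_inter_le hY s
  rw [hc] at hs0
  have hpos : 0 < (greenClass s).ncard :=
    (Set.ncard_pos (Set.toFinite _)).2 ⟨s, mem_greenClass_self s⟩
  obtain hn | hn : (greenClass s ∩ Y).ncard = 1 ∨ (greenClass s ∩ Y).ncard = 2 := by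
    have h₁ : 0 < (greenClass s ∩ Y).ncard := by omega
    have h₂ : (greenClass s ∩ Y).ncard ≤ 2 := by zify at *; nlinarith
    omega
  · exfalso
    obtain ⟨e, he⟩ := Set.ncard_eq_one.1 hn
    have hes : e ∈ greenClass s ∩ Y := by simp [he]
    have hcl := greenLE_of_mul_mem hSI (hidem e hes.2) (mul_mem_greenClass_of_ncard_two
      (hidem e hes.2) (by rw [greenClass_eq hes.1]; omega)) z
    exact hs (hzeq s (hcl.trans hes.1.2))
  · obtain ⟨e, f, hne, hY2⟩ := Set.ncard_eq_two.1 hn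
    have hes : e ∈ greenClass s ∩ Y := by simp [hY2]
    have hfs : f ∈ greenClass s ∩ Y := by simp [hY2]
    obtain ⟨x, hx, hx0, hx1⟩ := exists_isBrandtClass (hidem e hes.2) (hidem f hfs.2)
      (hcomm e hes.2 f hfs.2) hne hes.1 hfs.1 (by omega)
    exact ⟨x, hx, Fin.forall_fin_two.2 ⟨hx0 ▸ hes.2, hx1 ▸ hfs.2⟩⟩

end Extremal

/-! ### The semigroup algebra -/

section Algebra

variable {S : Type u} [Semigroup S]

namespace IsBrandtClass

variable {s : S} {x : Fin 2 → Fin 2 → S}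

theorem mul_mul_diag_eq_iff (h : IsBrandtClass (greenClass s) x) (t u : S) (i j : Fin 2) :
    t * u * x j j = x i j ↔ ∃ k, t * x k k = x i k ∧ u * x j j = x k j := by
  constructor
  · intro htu
    have hu : u * x j j ∈ greenClass s := by
      refine ⟨(h.mem j j).1.mul_left u, GreenLE.trans ?_ (h.mem i j).2⟩
      rw [← htu, mul_assoc]
      exact greenLE_mul_left _ _
    obtain ⟨k, l, hkl⟩ := h.exists_eq _ hu
    obtain rfl : l = j := by
      have hm := hu
      rw [← h.mul_eq j j j, ← mul_assoc, ← hkl, h.mul_mem_iff] at hm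
      exact hm
    refine ⟨k, ?_, hkl.symm⟩
    rw [← h.mul_eq k l k, ← mul_assoc, hkl, ← mul_assoc, htu, h.mul_eq]
  · rintro ⟨k, ht, hu⟩
    rw [mul_assoc, hu, ← h.mul_eq k k j, ← mul_assoc, ht, h.mul_eq]

open Classical in
/-- The matrix representation afforded by a Brandt `J`-class: left multiplication by `t` on a column
of matrix units, where a product that leaves the class counts as zero. The entry at `(i, j)` is
read off from the column of index `j`; any other column
would give the same entry. -/
noncomputable def matrixRep (h : IsBrandtClass (greenClass s) x) :
    S →ₙ* Matrix (Fin 2) (Fin 2) ℂ where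
  toFun t := Matrix.of fun i j => if t * x j j = x i j then 1 else 0
  map_mul' t u := by
    ext i j
    rw [Matrix.mul_apply]
    simp only [Matrix.of_apply, ite_zero_mul_ite_zero, mul_one]
    by_cases htu : t * u * x j j = x i j
    · obtain ⟨k, hk⟩ := (h.mul_mul_diag_eq_iff t u i j).1 htu
      rw [if_pos htu, Finset.sum_eq_single k, if_pos hk]
      · exact fun l _ hl => if_neg fun hl' => hl (h.eq_iff.1 (hl'.2.symm.trans hk.2)).1
      · exact fun hk => absurd (Finset.mem_univ k) hk
    · rw [if_neg htu, Finset.sum_eq_zero]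
      exact fun k _ => if_neg fun hk => htu ((h.mul_mul_diag_eq_iff t u i j).2 ⟨k, hk⟩)

open Classical in
theorem matrixRep_apply (h : IsBrandtClass (greenClass s) x) (t : S) (i j : Fin 2) :
    h.matrixRep t i j = if t * x j j = x i j then 1 else 0 := rfl

/-- The representation kills everything that is not above the class, and on the class itself it is
the map from matrix units to matrix units; so among elements not strictly above the class only
`x i j` has a nonzero entry at `(i, j)`. -/
theorem eq_of_matrixRep_ne_zero (h : IsBrandtClass (greenClass s) x) {t : S} {i j : Fin 2}
    (ht : GreenLE t s → GreenLE s t) (hne : h.matrixRep t i j ≠ 0) : t = x i j := by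
  classical
  rw [matrixRep_apply, ite_ne_right_iff] at hne
  have hle : GreenLE t s := by
    refine GreenLE.trans ?_ (h.mem i j).2
    rw [← hne.1]
    exact greenLE_mul_right _ _
  obtain ⟨k, l, rfl⟩ := h.exists_eq t ⟨ht hle, hle⟩
  obtain rfl : l = j := by rw [← h.mul_mem_iff (i := k) (l := j), hne.1]; exact h.mem i j
  rw [← hne.1, h.mul_eq]

theorem matrixRep_self (h : IsBrandtClass (greenClass s) x) (i j : Fin 2) :
    h.matrixRep (x i j) i j = 1 := by
  classical
  rw [matrixRep_apply, if_pos (h.mul_eq i j j)]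

end IsBrandtClass

/-- The representations attached to the `J`-classes together give a map onto the product of matrix
algebras. It is injective because the coefficient of a `J`-maximal element of the support can be
read off from the representation of its class; surjectivity follows from equality of dimensions. -/
theorem IsB2Stratified.exists_algebra_iso [Finite S] {Y : Subsemigroup S} {z : S}
    (h : IsB2Stratified Y z) :
    ∃ k : ℕ, Nat.card S = 4 * k + 1 ∧
      ∃ f : MonoidAlgebra ℂ S →ₙₐ[ℂ] ℂ × (Fin k → Matrix (Fin 2) (Fin 2) ℂ),
        Function.Bijective f := by
  classical
  have := Fintype.ofFinite S
  have hcard := h.natCard_eq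
  refine ⟨_, hcard, ?_⟩
  set k := Nat.card {q : Quotient (greenSetoid S) // q ≠ ⟦z⟧}
  let σ : {q : Quotient (greenSetoid S) // q ≠ ⟦z⟧} ≃ Fin k := Finite.equivFin _
  have hex : ∀ i : Fin k, ∃ (s : S) (x : Fin 2 → Fin 2 → S),
      IsBrandtClass (greenClass s) x ∧ (σ.symm i).1 = ⟦s⟧ := by
    intro i
    obtain ⟨s, hs⟩ := Quotient.exists_rep (σ.symm i).1
    obtain ⟨x, hx, -⟩ := h.exists_brandt s fun hsz => (σ.symm i).2 (by rw [← hs, hsz])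
    exact ⟨s, x, hx, hs.symm⟩
  choose r x hx hr using hex
  let φ : S →ₙ* ℂ × (Fin k → Matrix (Fin 2) (Fin 2) ℂ) :=
    { toFun := fun t => (1, fun i => (hx i).matrixRep t)
      map_mul' := fun t u => Prod.ext (mul_one 1).symm (funext fun i => map_mul _ t u) }
  let f := MonoidAlgebra.liftMagma ℂ φ
  have hf : ∀ a, f a = a.coeff.sum fun t c => c • φ t := fun a => by
    rw [MonoidAlgebra.liftMagma_apply_apply]
    rfl
  have hinj : Function.Injective f := by
    rw [injective_iff_map_eq_zero]
    intro a ha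
    by_contra hne
    have hsupp : {s | a.coeff s ≠ 0}.Nonempty := by
      by_contra! hemp
      refine hne (MonoidAlgebra.ext (Finsupp.ext fun s => ?_))
      by_contra hs
      exact (Set.ext_iff.1 hemp s).1 hs
    obtain ⟨s, hs, hmax⟩ := exists_greenLE_maximal hsupp
    -- It is enough to find a linear functional that reads off the coefficient of `a` at `s`.
    suffices hℓ : ∃ ℓ : ℂ × (Fin k → Matrix (Fin 2) (Fin 2) ℂ) →ₗ[ℂ] ℂ,
        ℓ (φ s) = 1 ∧ ∀ t, a.coeff t ≠ 0 → ℓ (φ t) ≠ 0 → t = s by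
      obtain ⟨ℓ, hℓs, hℓ⟩ := hℓ
      have h0 := congrArg ℓ ((hf a).symm.trans ha)
      rw [map_zero, Finsupp.sum, map_sum, Finset.sum_eq_single s] at h0
      · rw [map_smul, hℓs, smul_eq_mul, mul_one] at h0
        exact hs h0
      · intro t ht hts
        rw [map_smul, not_imp_comm.1 (hℓ t (Finsupp.mem_support_iff.1 ht)) hts, smul_zero]
      · exact fun hns => absurd (Finsupp.mem_support_iff.2 hs) hns
    by_cases hsz : s = z
    · refine ⟨LinearMap.fst ℂ _ _, rfl, fun t ht _ => ?_⟩
      rw [hsz] at hmax ⊢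
      exact h.eq_zero_of_greenLE (hmax t ht (h.greenLE_zero t))
    · have hsq : (⟦s⟧ : Quotient (greenSetoid S)) ≠ ⟦z⟧ := fun hq =>
        hsz (h.eq_zero_of_greenLE (Quotient.exact hq).2)
      obtain ⟨i, hi⟩ : ∃ i, σ.symm i = ⟨_, hsq⟩ := σ.symm.surjective _
      have hrs : GreenLE (r i) s ∧ GreenLE s (r i) :=
        Quotient.exact ((hr i).symm.trans (congrArg Subtype.val hi))
      obtain ⟨p, q, hpq⟩ := (hx i).exists_eq s hrs
      refine ⟨Matrix.entryLinearMap ℂ ℂ p q ∘ₗ LinearMap.proj i ∘ₗ LinearMap.snd ℂ _ _, ?_,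
        fun t ht hne => ?_⟩
      · rw [← hpq]
        exact (hx i).matrixRep_self p q
      · rw [← hpq]
        exact (hx i).eq_of_matrixRep_ne_zero
          (fun hle => hrs.1.trans (hmax t ht (hle.trans hrs.1))) hne
  refine ⟨f, hinj, ?_⟩
  have hfin : Module.finrank ℂ (MonoidAlgebra ℂ S) =
      Module.finrank ℂ (ℂ × (Fin k → Matrix (Fin 2) (Fin 2) ℂ)) := by
    rw [(MonoidAlgebra.coeffLinearEquiv ℂ).finrank_eq, Module.finrank_finsupp_self,
      ← Nat.card_eq_fintype_card, hcard]
    simp [Module.finrank_pi_fintype, Module.finrank_matrix]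
    ring
  have : FiniteDimensional ℂ (MonoidAlgebra ℂ S) :=
    Module.Finite.equiv (MonoidAlgebra.coeffLinearEquiv ℂ).symm
  let L : MonoidAlgebra ℂ S →ₗ[ℂ] ℂ × (Fin k → Matrix (Fin 2) (Fin 2) ℂ) := f
  exact (LinearMap.injective_iff_surjective_of_finrank_eq_finrank (f := L) hfin).1 hinj

end Algebra

theorem proposition3 {S : Type u} [Semigroup S] (hS : IsB2Combinatorial S) :
    (∃ z : S, ∀ s : S, z * s = z ∧ s * z = z) ∧
    (∃ k : ℕ, Nat.card S = 4 * k + 1 ∧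
      ∃ f : MonoidAlgebra ℂ S →ₙₐ[ℂ] ℂ × (Fin k → Matrix (Fin 2) (Fin 2) ℂ),
        Function.Bijective f) ∧
    (∀ (I : Set S) (hI : IsSemigroupIdeal I), IsB2Combinatorial hI.toSubsemigroup) ∧
    (∀ (T : Type v) [Semigroup T] (f : S →ₙ* T),
      Function.Surjective f → IsB2Combinatorial T) := by
  obtain ⟨Y, z, h⟩ := hS.exists_isB2Stratified
  have : Finite S := by
    obtain ⟨-, k, hk, -⟩ := hS
    exact Nat.finite_of_card_ne_zero (by omega)
  refine ⟨⟨z, fun s => ⟨h.zero_mul s, h.mul_zero s⟩⟩, h.exists_algebra_iso, fun I hI => ?_,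
    fun T _ f hf => ?_⟩
  · obtain ⟨z', h'⟩ := h.ideal hI
    have : Finite hI.toSubsemigroup := Subtype.finite
    exact h'.isB2Combinatorial
  · have := Finite.of_surjective f hf
    exact (h.map f hf).isB2Combinatorial
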